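/- Conventions: $d(x,\emptyset)=\infty$. Let $M\subset\mathbb{R}^k$ be a compact smooth submanifold without boundary, with normal spaces $N_p$. Its medial axis is the closure of the set of points of $\mathbb{R}^k$ with at least two closest points in $M$, and $\mathrm{lfs}(x)$ is the distance from $x\in M$ to the medial axis. A finite set $P\subset M$ is $c$-dense with respect to $\varphi:M\to[0,\infty]$ if $d(x,P)\le c\,\varphi(x)$ for all $x\in M$; it is $c$-sparse if $d(p,q)\ge c\,\varphi(p)$ for all distinct $p,q\in P$; it is $(c_1,c_2)$-uniform if it is $c_1$-dense and $c_2$-sparse. For $L\subset\mathbb{R}^k$, $P$ is a $(\delta,L)$-sample of $M$ if every $x\in M$ has a $p\in P$ with $d(x,p)\le\delta\, d(p,L)$. Let every $p\in P$ carry a linear subspace $V_p$ of $\mathbb{R}^k$ (an estimated normal space) with $\dim V_p=\dim N_p$. For $0<\beta<\pi/2$ a pair $(p,q)\in P\times P$ is $\beta$-good if the angles between the line $pq$ and $V_p$ and between $pq$ and $V_q$ are at most $\pi/2-\beta$ and the closed ball with centre $\frac{p+q}2$ and radius $\frac13\tan(\frac\beta2)\, d(p,q)$ contains no point of $P$. The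 lean set $L_\beta$ is the set of midpoints of all $\beta$-good pairs, and $\mathrm{lnfs}_\beta(x)=d(x,L_\beta)$. The algorithm $\mathrm{Lean}(P,\beta,\rho)$ puts $P$ into a queue and, as long as the queue is nonempty, extracts a point $q$ with the largest value of $\mathrm{lnfs}_\beta$ (ties broken arbitrarily), adds $q$ to the output $Q$, and deletes from the queue all $p$ with $d(q,p)\le\rho\,\mathrm{lnfs}_\beta(q)$. **Theorem.** Let $0<\beta<\pi/2$, $0<\rho\le\frac1{12}$, and let $\nu_\varepsilon=O(\varepsilon)$ as $\varepsilon\to0^+$. There is $\varepsilon_0>0$, depending only on $\beta$, $\rho$ and the function $\varepsilon\mapsto\nu_\varepsilon$, such that for all $0<\varepsilon\le\varepsilon_0$ the following holds. Let $P$ be a nonempty finite sample of a compact smooth submanifold $M\subset\mathbb{R}^k$ without boundary which is $\varepsilon$-dense with respect to $\mathrm{lfs}$, with estimated normal spaces $V_p$ such that $\dim V_p=\dim N_p$ and the (largest principal) angle between $V_p$ and $N_p$ is at most $\nu_\varepsilon$ for all $p\in P$. Then every output $Q$ of $\mathrm{Lean}(P,\beta,\rho)$ is a $(\frac43\rho,\rho)$-uniform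 sample of $M$ with respect to $\mathrm{lnfs}_\beta$, and $Q$ is a $(\frac{6\rho}5,L_\beta)$-sample of $M$. -/

import Mathlib

open Set Filter Topology Asymptotics
open scoped ENNReal ContDiff

namespace Sparsification

noncomputable section

/-- The ambient Euclidean space `ℝᵏ`. -/
abbrev Space (k : ℕ) : Type := EuclideanSpace ℝ (Fin k)

variable {k : ℕ}

/-! ### Submanifolds and their normal spaces -/

/-- `M` is a smooth (`C^∞`) embedded `s`-dimensional submanifold without boundary of `ℝᵏ`:
around each of its points, a smooth diffeomorphism between open subsets of `ℝᵏ` straightens `M` to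
an `s`-dimensional linear subspace. -/
def IsSmoothSubmanifold (s : ℕ) (M : Set (Space k)) : Prop :=
  ∀ x ∈ M, ∃ (φ : OpenPartialHomeomorph (Space k) (Space k)) (W : Submodule ℝ (Space k)),
    x ∈ φ.source ∧ ContDiffOn ℝ ∞ φ φ.source ∧ ContDiffOn ℝ ∞ φ.symm φ.target ∧
    Module.finrank ℝ W = s ∧ ∀ y ∈ φ.source, (y ∈ M ↔ φ y ∈ W)

/-- The tangent space of `M` at `x` (for a submanifold the tangent cone is already a linear
subspace). -/
def tangentSpace (M : Set (Space k)) (x : Space k) : Submodule ℝ (Space k) :=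
  Submodule.span ℝ (tangentConeAt ℝ M x)

/-- The normal space of `M` at `x`. -/
def normalSpace (M : Set (Space k)) (x : Space k) : Submodule ℝ (Space k) :=
  (tangentSpace M x)ᗮ

/-! ### Angles -/

/-- The angle between the line spanned by `u ≠ 0` and the linear subspace `V`, in `[0, π/2]`: the
angle between `u` and its orthogonal projection to `V` (and `π/2` if that projection is zero). -/
def lineAngle (V : Submodule ℝ (Space k)) (u : Space k) : ℝ :=
  InnerProductGeometry.angle u (V.starProjection u)

/-- The angle between two linear subspaces of the same dimension, i.e. their largest principal
angle: the largest angle between a line in `U` and the subspace `V`. -/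
def subspaceAngle (U V : Submodule ℝ (Space k)) : ℝ :=
  sSup {a : ℝ | ∃ u ∈ U, u ≠ 0 ∧ a = lineAngle V u}

/-! ### Medial axis and local feature size -/

/-- The closest points of `x` in `M`. -/
def closestPoints (M : Set (Space k)) (x : Space k) : Set (Space k) :=
  {y | y ∈ M ∧ dist x y = Metric.infDist x M}

/-- The medial axis of `M`. -/
def medialAxis (M : Set (Space k)) : Set (Space k) :=
  closure {m | (closestPoints M m).Nontrivial}

/-- The local feature size of `M` at `x`, the distance to the medial axis
(with the convention that the distance to the empty set is `∞`). -/
def lfs (M : Set (Space k)) (x : Space k) : ℝ≥0∞ :=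
  Metric.infEDist x (medialAxis M)

/-! ### Sampling conditions -/

/-- The sample `P ⊆ M` is `c`-dense with respect to `φ`. -/
def IsDenseSample (M : Set (Space k)) (c : ℝ) (φ : Space k → ℝ≥0∞) (P : Finset (Space k)) : Prop :=
  (P : Set (Space k)) ⊆ M ∧
    ∀ x ∈ M, Metric.infEDist x (P : Set (Space k)) ≤ ENNReal.ofReal c * φ x

/-- `P` is `c`-sparse with respect to `φ`. -/
def IsSparseSample (c : ℝ) (φ : Space k → ℝ≥0∞) (P : Finset (Space k)) : Prop :=
  ∀ p ∈ P, ∀ q ∈ P, p ≠ q → ENNReal.ofReal c * φ p ≤ edist p q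

/-- The sample `P ⊆ M` is `(c₁, c₂)`-uniform with respect to `φ`. -/
def IsUniformSample (M : Set (Space k)) (c₁ c₂ : ℝ) (φ : Space k → ℝ≥0∞)
    (P : Finset (Space k)) : Prop :=
  IsDenseSample M c₁ φ P ∧ IsSparseSample c₂ φ P

/-- The finite set `P ⊆ M` is a `(δ, L)`-sample of `M`. -/
def IsLSample (M : Set (Space k)) (δ : ℝ) (L : Set (Space k)) (P : Finset (Space k)) : Prop :=
  (P : Set (Space k)) ⊆ M ∧
    ∀ x ∈ M, ∃ p ∈ P, edist x p ≤ ENNReal.ofReal δ * Metric.infEDist p L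

/-! ### The lean set and the lean feature size

Here `V p` is the estimated normal space at the sample point `p`. -/

/-- The constant `c_β = (1/3) tan (β/2)`. -/
def goodConst (β : ℝ) : ℝ := 1 / 3 * Real.tan (β / 2)

/-- `(p, q)` is a `β`-good pair of points of `P`. (The empty-ball condition forces `p ≠ q`.) -/
def IsGoodPair (P : Finset (Space k)) (V : Space k → Submodule ℝ (Space k)) (β : ℝ)
    (p q : Space k) : Prop :=
  p ∈ P ∧ q ∈ P ∧
    max (lineAngle (V p) (q - p)) (lineAngle (V q) (q - p)) ≤ Real.pi / 2 - β ∧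
    ∀ x ∈ P, x ∉ Metric.closedBall (midpoint ℝ p q) (goodConst β * dist p q)

/-- The `β`-lean set: the midpoints of the `β`-good pairs. -/
def leanSet (P : Finset (Space k)) (V : Space k → Submodule ℝ (Space k)) (β : ℝ) :
    Set (Space k) :=
  {v | ∃ p q, IsGoodPair P V β p q ∧ v = midpoint ℝ p q}

/-- The `β`-lean feature size, the distance to the `β`-lean set
(with the convention that the distance to the empty set is `∞`). -/
def lnfs (P : Finset (Space k)) (V : Space k → Submodule ℝ (Space k)) (β : ℝ) (x : Space k) :
    ℝ≥0∞ :=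
  Metric.infEDist x (leanSet P V β)

/-! ### The greedy decimation -/

open Classical in
/-- `Decimate ρ φ S Q`: some run of the decimation loop started with the queue `S` and the priority
`φ` collects exactly the set `Q`. While the queue is nonempty, the loop extracts an element `q` of
maximal priority (ties are broken arbitrarily), puts it into the output, and deletes from the
queue all `p` with `d(q, p) ≤ ρ φ(q)`. -/
inductive Decimate (ρ : ℝ) (φ : Space k → ℝ≥0∞) : Finset (Space k) → Finset (Space k) → Prop
  | done : Decimate ρ φ ∅ ∅
  | step (S Q : Finset (Space k)) (q : Space k) (hq : q ∈ S) (hmax : ∀ p ∈ S, φ p ≤ φ q)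
      (hrun : Decimate ρ φ ((S.erase q).filter fun p => ¬ edist q p ≤ ENNReal.ofReal ρ * φ q) Q) :
      Decimate ρ φ S (insert q Q)

/-- The decimation loop always terminates with an output. -/
theorem exists_decimate (ρ : ℝ) (φ : Space k → ℝ≥0∞) (S : Finset (Space k)) :
    ∃ Q, Decimate ρ φ S Q := by
  classical
  induction S using Finset.strongInduction with
  | H S ih =>
    rcases S.eq_empty_or_nonempty with rfl | hS
    · exact ⟨∅, .done⟩
    · obtain ⟨q, hq, hmax⟩ := S.exists_max_image φ hS
      obtain ⟨Q, hQ⟩ := ih _ ((Finset.filter_subset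
        (fun p => ¬ edist q p ≤ ENNReal.ofReal ρ * φ q) _).trans_ssubset (Finset.erase_ssubset hq))
      refine ⟨insert q Q, .step S Q q hq hmax ?_⟩
      convert hQ

/-- `Q` is an output of the algorithm `Lean(P, β, ρ)`: the points of `P` are decimated with
priority `lnfs`. -/
def IsDecimationOutput (P : Finset (Space k)) (V : Space k → Submodule ℝ (Space k)) (β ρ : ℝ)
    (Q : Finset (Space k)) : Prop :=
  Decimate ρ (lnfs P V β) P Q

end

end Sparsification

open Sparsification

namespace Sparsification

variable {k : ℕ}

/-! ### Second order contact of a submanifold with its tangent spaces -/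

/-! The heart is a comparison `lfs ≤ C * lnfs` on `M` with `C` depending only on `β`
(`lfs_le_mul_lnfs`). It turns `ε`-density for `lfs` into `C * ε`-density for `lnfs`, after which
only the greedy loop and the 1-Lipschitz property of the distance to the lean set matter.

For the comparison, let `(p, q)` be a good pair with midpoint `m`. If `V p` is within `β / 2` of the
normal space, the line `pq` makes an angle of at most `π / 2 - β / 2` with a true normal at `p`.
Balls of radius below `lfs p` touching `M` at `p` contain no point of `M` in their interior, so `lfs
p ≤ dist p q / (2 sin (β / 2))`. The empty ball of the good pair keeps the sample point nearest to
`x` away from `m`, which bounds `dist p q` by a multiple of `dist x m + ε * lfs x`. As `lfs` is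
1-Lipschitz, `lfs x` is bounded by the same kind of expression, and for small `ε` its `lfs x` term
is absorbed.

The tangent ball property is proved by growing the ball. Small balls are empty by second order
contact. Away from the medial axis the distance to `M` has slope 1, so an empty ball centred there
can be enlarged. -/

theorem fderiv_symm_mem_tangentSpace {M : Set (Space k)}
    {φ : OpenPartialHomeomorph (Space k) (Space k)} {W : Submodule ℝ (Space k)} {x : Space k}
    (hx : x ∈ φ.source) (hxM : x ∈ M) (hW : ∀ y ∈ φ.source, (y ∈ M ↔ φ y ∈ W))
    (hφ : DifferentiableAt ℝ φ.symm (φ x)) {v : Space k} (hv : v ∈ W) :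
    fderiv ℝ φ.symm (φ x) v ∈ tangentSpace M x := by
  have hxW : φ x ∈ W := (hW x hx).1 hxM
  have hcone : v ∈ tangentConeAt ℝ ((W : Set (Space k)) ∩ φ.target) (φ x) := by
    rw [tangentConeAt_inter_nhds (φ.open_target.mem_nhds (φ.map_source hx))]
    have hseg : segment ℝ (φ x) (φ x + v) ⊆ (W : Set (Space k)) :=
      W.convex.segment_subset hxW (W.add_mem hxW hv)
    simpa using mem_tangentConeAt_of_segment_subset hseg
  have himage := hφ.hasFDerivAt.hasFDerivWithinAt.mapsTo_tangent_cone hcone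
  rw [φ.left_inv hx] at himage
  refine Submodule.subset_span (tangentConeAt_mono ?_ himage)
  rintro _ ⟨w, ⟨hwW, hwt⟩, rfl⟩
  rw [hW _ (φ.map_target hwt), φ.right_inv hwt]
  exact hwW

/-- The derivative is Lipschitz near `a`, so on the ball of radius `‖w - a‖` it varies by at most `K
* ‖w - a‖`; the mean value inequality gives the square. -/
theorem exists_norm_sub_fderiv_le_sq {E F : Type*} [NormedAddCommGroup E] [NormedSpace ℝ E]
    [NormedAddCommGroup F] [NormedSpace ℝ F] {f : E → F} {a : E} (hf : ContDiffAt ℝ 2 f a) :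
    ∃ C : ℝ, 0 ≤ C ∧ ∀ᶠ w in 𝓝 a, ‖f w - f a - fderiv ℝ f a (w - a)‖ ≤ C * ‖w - a‖ ^ 2 := by
  have hf' : ContDiffAt ℝ 1 (fderiv ℝ f) a := hf.fderiv_right (by norm_num)
  obtain ⟨K, t, ht, hK⟩ := hf'.exists_lipschitzOnWith
  have hdiff : ∀ᶠ w in 𝓝 a, DifferentiableAt ℝ f w :=
    (hf.eventually (by simp)).mono fun w hw => hw.differentiableAt (by norm_num)
  obtain ⟨r, hr, hball⟩ := Metric.mem_nhds_iff.1 (inter_mem ht hdiff)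
  refine ⟨K, K.2, ?_⟩
  filter_upwards [Metric.ball_mem_nhds a hr] with w hw
  have hsub : Metric.closedBall a ‖w - a‖ ⊆ Metric.ball a r := by
    apply Metric.closedBall_subset_ball
    rwa [← dist_eq_norm]
  have hbound := (convex_closedBall a ‖w - a‖).norm_image_sub_le_of_norm_fderiv_le'
    (f := f) (φ := fderiv ℝ f a) (C := K * ‖w - a‖) (x := a) (y := w)
    (fun y hy => (hball (hsub hy)).2) (fun y hy => by
      have hle := hK.dist_le_mul y (hball (hsub hy)).1 a (mem_of_mem_nhds ht)
      rw [dist_eq_norm] at hle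
      refine hle.trans ?_
      gcongr
      exact hy)
    (Metric.mem_closedBall_self (norm_nonneg _)) (by simp [dist_eq_norm])
  refine hbound.trans_eq (by ring)

/-- In a straightening chart the first order Taylor term of `q - x` is tangent, hence orthogonal to
`n`, and only the quadratic remainder contributes. -/
theorem IsSmoothSubmanifold.exists_inner_normal_le {s : ℕ} {M : Set (Space k)}
    (hM : IsSmoothSubmanifold s M) {x : Space k} (hx : x ∈ M) :
    ∃ C : ℝ, 0 < C ∧ ∀ᶠ q in 𝓝 x, q ∈ M → ∀ n ∈ normalSpace M x,
      inner ℝ (q - x) n ≤ C * ‖q - x‖ ^ 2 * ‖n‖ := by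
  obtain ⟨φ, W, hxs, hφ, hψ, -, hW⟩ := hM x hx
  have hφx : ContDiffAt ℝ ∞ φ x := hφ.contDiffAt (φ.open_source.mem_nhds hxs)
  have hψx : ContDiffAt ℝ ∞ φ.symm (φ x) :=
    hψ.contDiffAt (φ.open_target.mem_nhds (φ.map_source hxs))
  obtain ⟨C, hC, hquad⟩ := exists_norm_sub_fderiv_le_sq (by exact_mod_cast contDiffAt_infty.1 hψx 2)
  obtain ⟨K, t, ht, hK⟩ := (hφx.of_le (by exact_mod_cast le_top) :
    ContDiffAt ℝ 1 φ x).exists_lipschitzOnWith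
  refine ⟨C * K ^ 2 + 1, by positivity, ?_⟩
  filter_upwards [hφx.continuousAt.eventually hquad, ht, φ.open_source.mem_nhds hxs]
    with q hq hqt hqs hqM n hn
  have hxW : φ x ∈ W := (hW x hxs).1 hx
  have hqW : φ q ∈ W := (hW q hqs).1 hqM
  rw [φ.left_inv hqs, φ.left_inv hxs] at hq
  have hortho : inner ℝ (fderiv ℝ φ.symm (φ x) (φ q - φ x)) n = 0 :=
    (Submodule.mem_orthogonal _ _).1 hn _ (fderiv_symm_mem_tangentSpace hxs hx hW
      (hψx.differentiableAt (by simp)) (W.sub_mem hqW hxW))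
  have hlip : ‖φ q - φ x‖ ≤ K * ‖q - x‖ := by
    simpa [dist_eq_norm] using hK.dist_le_mul q hqt x (mem_of_mem_nhds ht)
  calc inner ℝ (q - x) n
      = inner ℝ (q - x - fderiv ℝ φ.symm (φ x) (φ q - φ x)) n := by
        rw [inner_sub_left (q - x) _ n, hortho, sub_zero]
    _ ≤ ‖q - x - fderiv ℝ φ.symm (φ x) (φ q - φ x)‖ * ‖n‖ := real_inner_le_norm _ _
    _ ≤ (C * (K * ‖q - x‖) ^ 2) * ‖n‖ := by
        gcongr
        exact hq.trans (by gcongr)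
    _ ≤ (C * K ^ 2 + 1) * ‖q - x‖ ^ 2 * ‖n‖ := by
        rw [mul_pow, ← mul_assoc]
        gcongr
        linarith

theorem IsSmoothSubmanifold.exists_le_dist_normal {s : ℕ} {M : Set (Space k)}
    (hM : IsSmoothSubmanifold s M) {x : Space k} (hx : x ∈ M) :
    ∃ t : ℝ, 0 < t ∧ ∀ n ∈ normalSpace M x, ‖n‖ = 1 → ∀ q ∈ M, t ≤ dist (x + t • n) q := by
  obtain ⟨C, hC, hev⟩ := hM.exists_inner_normal_le hx
  obtain ⟨r, hr, hball⟩ := Metric.eventually_nhds_iff.1 hev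
  -- The bound `1 / (2 * C)` lets the quadratic estimate handle `q` within `r` of `x`; the bound `r
  -- / 2` handles all other `q` by the triangle inequality.
  refine ⟨min (1 / (2 * C)) (r / 2), by positivity, fun n hn hn1 q hq => ?_⟩
  set t := min (1 / (2 * C)) (r / 2)
  have ht : 0 < t := by positivity
  have htC : 2 * C * t ≤ 1 := by
    have : t ≤ 1 / (2 * C) := min_le_left _ _
    rwa [le_div_iff₀ (by positivity), mul_comm] at this
  have htr : t ≤ r / 2 := min_le_right _ _
  by_cases hqr : dist q x < r
  · have hin := hball hqr hq n hn
    have hexp : dist (x + t • n) q ^ 2 = t ^ 2 - 2 * t * inner ℝ (q - x) n + ‖q - x‖ ^ 2 := by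
      have : x + t • n - q = t • n - (q - x) := by abel
      rw [dist_eq_norm, this, norm_sub_sq_real, norm_smul, hn1, real_inner_smul_left,
        real_inner_comm, Real.norm_of_nonneg ht.le]
      ring
    rw [hn1, mul_one] at hin
    refine le_of_sq_le_sq ?_ dist_nonneg
    rw [hexp]
    nlinarith [sq_nonneg ‖q - x‖]
  · have h1 : dist (x + t • n) x = t := by
      simp [dist_eq_norm, norm_smul, hn1, abs_of_pos ht]
    have h2 := dist_triangle q (x + t • n) x
    rw [h1, dist_comm q (x + t • n)] at h2
    linarith [not_lt.1 hqr]

/-! ### Growth of the distance function away from the medial axis -/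

/-- At a point with a unique closest point in `M`, the distance to `M` has slope at least `1 - η`
in the direction away from the closest point. -/
theorem exists_infDist_add_smul_ge {M : Set (Space k)} (hM : IsCompact M) {y a : Space k}
    (ha : closestPoints M y = {a}) (hy : 0 < Metric.infDist y M) {η : ℝ} (hη : 0 < η)
    (hη1 : η < 1) :
    ∃ v : Space k, ‖v‖ = 1 ∧ ∀ᶠ s in 𝓝[>] (0 : ℝ),
      Metric.infDist y M + (1 - η) * s ≤ Metric.infDist (y + s • v) M := by
  obtain ⟨haM, had⟩ : a ∈ closestPoints M y := ha ▸ mem_singleton a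
  set δ := Metric.infDist y M
  have hne : M.Nonempty := ⟨a, haM⟩
  have hnorm : ‖y - a‖ = δ := by rw [← dist_eq_norm, had]
  set v := δ⁻¹ • (y - a) with hv
  have hδv : y - a = δ • v := by rw [hv, smul_inv_smul₀ hy.ne']
  have hv1 : ‖v‖ = 1 := by
    rw [hv, norm_smul, hnorm, norm_inv, Real.norm_of_nonneg hy.le, inv_mul_cancel₀ hy.ne']
  refine ⟨v, hv1, ?_⟩
  choose! g hgM hg using fun z : Space k => hM.exists_infDist_eq_dist hne z
  have hcont : Tendsto (fun s : ℝ => y + s • v) (𝓝 0) (𝓝 y) := by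
    have : Continuous fun s : ℝ => y + s • v := by fun_prop
    simpa using this.tendsto 0
  -- Closest points are chosen without continuity, but by compactness and uniqueness their only
  -- cluster point at `s = 0` is `a`.
  have hlim : Tendsto (fun s : ℝ => g (y + s • v)) (𝓝 0) (𝓝 a) := by
    refine hM.tendsto_nhds_of_unique_mapClusterPt (Eventually.of_forall fun s => hgM _) ?_
    intro b hbM hb
    have hzero : Tendsto (fun s : ℝ => dist y (g (y + s • v))) (𝓝 0) (𝓝 δ) := by
      have h1 : Tendsto (fun s : ℝ => Metric.infDist (y + s • v) M) (𝓝 0) (𝓝 δ) :=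
        ((Metric.continuous_infDist_pt M).tendsto y).comp hcont
      have h2 : Tendsto (fun s : ℝ => dist (y + s • v) y) (𝓝 0) (𝓝 0) := by
        simpa using hcont.dist (tendsto_const_nhds (x := y))
      refine tendsto_of_tendsto_of_tendsto_of_le_of_le tendsto_const_nhds
        (h := fun s => Metric.infDist (y + s • v) M + dist (y + s • v) y)
        (by simpa only [add_zero] using h1.add h2)
        (fun s => Metric.infDist_le_dist_of_mem (hgM _)) fun s => ?_
      have := dist_triangle_left y (g (y + s • v)) (y + s • v)
      simp only [hg]
      linarith
    have hdb : MapClusterPt (dist y b) (𝓝 (0 : ℝ)) (fun s : ℝ => dist y (g (y + s • v))) :=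
      hb.continuousAt_comp (f := fun z => dist y z) (by fun_prop)
    have hdb' : dist y b = δ := by
      have : ClusterPt (dist y b) (𝓝 δ) := ClusterPt.mono hdb hzero
      exact t2_iff_nhds.1 inferInstance this
    have : b ∈ closestPoints M y := ⟨hbM, hdb'⟩
    simpa [ha] using this
  have hinner : ∀ᶠ s in 𝓝 (0 : ℝ), (1 - η) * δ < inner ℝ v (y - g (y + s • v)) := by
    have hto : Tendsto (fun s : ℝ => inner ℝ v (y - g (y + s • v))) (𝓝 0)
        (𝓝 (inner ℝ v (y - a))) :=
      Tendsto.inner tendsto_const_nhds (tendsto_const_nhds.sub hlim)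
    refine hto.eventually (lt_mem_nhds ?_)
    rw [hδv, real_inner_smul_right, real_inner_self_eq_norm_sq, hv1]
    nlinarith
  filter_upwards [nhdsWithin_le_nhds hinner, self_mem_nhdsWithin] with s hs1 hs
  have hs : 0 < s := hs
  rw [hg]
  set b := g (y + s • v)
  have hδb : δ ≤ ‖y - b‖ := by
    rw [← dist_eq_norm]; exact Metric.infDist_le_dist_of_mem (hgM _)
  have hexp : dist (y + s • v) b ^ 2 = ‖y - b‖ ^ 2 + 2 * s * inner ℝ v (y - b) + s ^ 2 := by
    have : y + s • v - b = s • v + (y - b) := by abel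
    rw [dist_eq_norm, this, norm_add_sq_real, norm_smul, hv1, real_inner_smul_left,
      Real.norm_of_nonneg hs.le]
    ring
  refine le_of_sq_le_sq ?_ dist_nonneg
  rw [hexp]
  have h2 := mul_le_mul_of_nonneg_left hs1.le hs.le
  have h3 : δ ^ 2 ≤ ‖y - b‖ ^ 2 := by gcongr
  have h4 : (1 - η) ^ 2 * s ^ 2 ≤ s ^ 2 := by
    have : (1 - η) ^ 2 ≤ 1 := by nlinarith
    nlinarith [sq_nonneg s]
  nlinarith

/-- Maximize `infDist y M - (1 - η) * dist y y₀` over the ball. An interior maximum would contradict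
the slope `1 - η / 2` available there, so the maximum lies on the sphere; then let `η` tend to 0. -/
theorem exists_mem_closedBall_infDist_ge {M : Set (Space k)} (hM : IsCompact M)
    (hne : M.Nonempty) {y₀ : Space k} {h : ℝ} (hh : 0 < h) (hlt : h < Metric.infDist y₀ M)
    (huniq : ∀ y ∈ Metric.closedBall y₀ h, (closestPoints M y).Subsingleton) :
    ∃ y ∈ Metric.closedBall y₀ h, Metric.infDist y₀ M + h ≤ Metric.infDist y M := by
  have hball : IsCompact (Metric.closedBall y₀ h) := isCompact_closedBall y₀ h
  have hballne : (Metric.closedBall y₀ h).Nonempty := ⟨y₀, Metric.mem_closedBall_self hh.le⟩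
  have key : ∀ η : ℝ, 0 < η → η < 1 →
      ∃ y ∈ Metric.closedBall y₀ h, Metric.infDist y₀ M + (1 - η) * h ≤ Metric.infDist y M := by
    intro η hη hη1
    have hcont : Continuous fun y : Space k => Metric.infDist y M - (1 - η) * dist y y₀ :=
      (Metric.continuous_infDist_pt M).sub (by fun_prop)
    obtain ⟨y, hy, hmax⟩ := hball.exists_isMaxOn hballne hcont.continuousOn
    have hmax' : ∀ z ∈ Metric.closedBall y₀ h,
        Metric.infDist z M - (1 - η) * dist z y₀ ≤ Metric.infDist y M - (1 - η) * dist y y₀ :=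
      fun z hz => hmax hz
    refine ⟨y, hy, ?_⟩
    rcases (Metric.mem_closedBall.1 hy).eq_or_lt with heq | hin
    · have := hmax' y₀ (Metric.mem_closedBall_self hh.le)
      rw [heq, dist_self] at this
      linarith
    · exfalso
      have hpos : 0 < Metric.infDist y M := by
        have := Metric.infDist_le_infDist_add_dist (s := M) (x := y₀) (y := y)
        rw [dist_comm] at this
        linarith
      obtain ⟨a, haM, had⟩ := hM.exists_infDist_eq_dist hne y
      have ha : closestPoints M y = {a} :=
        (huniq y hy).eq_singleton_of_mem ⟨haM, had.symm⟩
      obtain ⟨v, hv, hev⟩ := exists_infDist_add_smul_ge hM ha hpos (half_pos hη) (by linarith)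
      have hsmall : ∀ᶠ s in 𝓝[>] (0 : ℝ), s < h - dist y y₀ :=
        nhdsWithin_le_nhds (gt_mem_nhds (by linarith))
      obtain ⟨s, ⟨hs1, hs2⟩, hs⟩ := ((hev.and hsmall).and self_mem_nhdsWithin).exists
      have hs : 0 < s := hs
      have hd : dist (y + s • v) y₀ ≤ s + dist y y₀ := by
        refine (dist_triangle _ y _).trans (add_le_add_left (le_of_eq ?_) _)
        simp [dist_eq_norm, norm_smul, hv, abs_of_pos hs]
      have := hmax' (y + s • v) (Metric.mem_closedBall.2 (by linarith))
      nlinarith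
  obtain ⟨y, hy, hmax⟩ :=
    hball.exists_isMaxOn hballne (Metric.continuous_infDist_pt M).continuousOn
  refine ⟨y, hy, le_of_forall_pos_le_add fun e he => ?_⟩
  obtain ⟨z, hz, hzle⟩ := key (min (1 / 2) (e / h)) (by positivity)
    ((min_le_left _ _).trans_lt (by norm_num))
  have h1 : Metric.infDist z M ≤ Metric.infDist y M := hmax hz
  have h2 : min (1 / 2) (e / h) * h ≤ e := by
    rw [← le_div_iff₀ hh]
    exact min_le_right _ _
  linarith

/-! ### Tangent balls of radius less than the local feature size -/

theorem exists_infDist_normal_gt {M : Set (Space k)} (hM : IsCompact M) {p n : Space k}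
    (hp : p ∈ M) (hn : ‖n‖ = 1) {t : ℝ} (ht : 0 < t) (hdist : t ≤ Metric.infDist (p + t • n) M)
    (hmed : p + t • n ∉ medialAxis M) :
    ∃ u, t < u ∧ u ≤ Metric.infDist (p + u • n) M := by
  have hself : ∀ u : ℝ, 0 ≤ u → dist (p + u • n) p = u := fun u hu => by
    simp [dist_eq_norm, norm_smul, hn, abs_of_nonneg hu]
  have heq : Metric.infDist (p + t • n) M = t :=
    le_antisymm ((Metric.infDist_le_dist_of_mem hp).trans_eq (hself t ht.le)) hdist
  obtain ⟨r, hr, hball⟩ := Metric.mem_nhds_iff.1 (isClosed_closure.isOpen_compl.mem_nhds hmed)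
  set h := min (r / 2) (t / 2)
  have hh : 0 < h := by positivity
  have hhr : h < r := (min_le_left _ _).trans_lt (by linarith)
  have hht : h < t := (min_le_right _ _).trans_lt (by linarith)
  obtain ⟨y, hy, hge⟩ := exists_mem_closedBall_infDist_ge hM ⟨p, hp⟩ hh (heq.symm ▸ hht)
    fun y hy => not_nontrivial_iff.1 fun hnt =>
      hball (Metric.closedBall_subset_ball hhr hy) (subset_closure hnt)
  rw [heq] at hge
  set w := y - (p + t • n) with hw
  have hwh : ‖w‖ ≤ h := by rwa [hw, ← dist_eq_norm]
  have hyp : t + h ≤ ‖w + t • n‖ := by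
    have : w + t • n = y - p := by rw [hw]; abel
    rw [this, ← dist_eq_norm]
    exact hge.trans (Metric.infDist_le_dist_of_mem hp)
  have hwn : h ≤ inner ℝ w n := by
    have h1 : (t + h) ^ 2 ≤ ‖w + t • n‖ ^ 2 := by gcongr
    rw [norm_add_sq_real, norm_smul, hn, real_inner_smul_right, Real.norm_of_nonneg ht.le] at h1
    have h2 : ‖w‖ ^ 2 ≤ h ^ 2 := by gcongr
    by_contra! hlt
    nlinarith [mul_lt_mul_of_pos_left hlt ht]
  -- Equality in the triangle inequality: `y` is within `h` of the centre yet at least `t + h` from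
  -- `p`, so it lies on the normal ray.
  have hzero : ‖w - h • n‖ ^ 2 ≤ 0 := by
    rw [norm_sub_sq_real, norm_smul, hn, real_inner_smul_right, Real.norm_of_nonneg hh.le]
    have h2 : ‖w‖ ^ 2 ≤ h ^ 2 := by gcongr
    nlinarith
  have hwz : w = h • n := by
    rw [← sub_eq_zero, ← norm_eq_zero]
    exact pow_eq_zero_iff two_ne_zero |>.1 (le_antisymm hzero (sq_nonneg _))
  have hyeq : y = p + (t + h) • n := by
    rw [add_smul, ← hwz, hw]; abel
  exact ⟨t + h, by linarith, hyeq ▸ hge⟩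

/-- The radii of empty tangent balls in direction `n` form a closed, downward closed set. If its
supremum were at most `r < lfs p`, the corresponding centre would be off the medial axis and the
ball could still grow. -/
theorem IsSmoothSubmanifold.le_infDist_normal {s : ℕ} {M : Set (Space k)}
    (hM : IsSmoothSubmanifold s M) (hc : IsCompact M) {p n : Space k} (hp : p ∈ M)
    (hnp : n ∈ normalSpace M p) (hn : ‖n‖ = 1) {r : ℝ} (hr : ENNReal.ofReal r < lfs M p) :
    r ≤ Metric.infDist (p + r • n) M := by
  set S : Set ℝ := {t | t ≤ Metric.infDist (p + t • n) M}
  have hclosed : IsClosed S := isClosed_le continuous_id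
    ((Metric.continuous_infDist_pt M).comp (by fun_prop))
  have hdown : ∀ t ∈ S, ∀ u ≤ t, u ∈ S := fun t ht u hu => by
    have h1 := Metric.infDist_le_infDist_add_dist (s := M) (x := p + t • n) (y := p + u • n)
    have h2 : dist (p + t • n) (p + u • n) = t - u := by
      rw [dist_add_left, dist_eq_norm, ← sub_smul, norm_smul, hn,
        Real.norm_of_nonneg (sub_nonneg.2 hu), mul_one]
    have ht : t ≤ Metric.infDist (p + t • n) M := ht
    change u ≤ Metric.infDist (p + u • n) M
    linarith
  obtain ⟨t, ht, hbase⟩ := hM.exists_le_dist_normal hp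
  have htS : t ∈ S := (Metric.le_infDist ⟨p, hp⟩).2 fun {q} hq => hbase n hnp hn q hq
  by_contra hrS
  have hbdd : BddAbove S := ⟨r, fun u hu => by
    by_contra! hlt
    exact hrS (hdown u hu r hlt.le)⟩
  have hsup : sSup S ∈ S := hclosed.csSup_mem ⟨t, htS⟩ hbdd
  have hle : sSup S ≤ r := by
    by_contra! hlt
    exact hrS (hdown _ hsup r hlt.le)
  have hpos : 0 < sSup S := ht.trans_le (le_csSup hbdd htS)
  obtain ⟨u, hu, huS⟩ := exists_infDist_normal_gt hc hp hn hpos hsup fun hmem => by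
    have h1 : lfs M p ≤ edist p (p + sSup S • n) := Metric.infEDist_le_edist_of_mem hmem
    rw [edist_dist, dist_self_add_right, norm_smul, hn, mul_one,
      Real.norm_of_nonneg hpos.le] at h1
    exact (h1.trans (ENNReal.ofReal_le_ofReal hle)).not_gt hr
  exact (le_csSup hbdd huS).not_gt hu

/-- Points of `M` lie outside the balls of radius `r < lfs p` that touch `M` at `p`. -/
theorem IsSmoothSubmanifold.two_mul_inner_normal_le {s : ℕ} {M : Set (Space k)}
    (hM : IsSmoothSubmanifold s M) (hc : IsCompact M) {p q n : Space k} (hp : p ∈ M) (hq : q ∈ M)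
    (hnp : n ∈ normalSpace M p) {r : ℝ} (hr₀ : 0 ≤ r) (hr : ENNReal.ofReal r < lfs M p) :
    2 * r * inner ℝ (q - p) n ≤ ‖q - p‖ ^ 2 * ‖n‖ := by
  rcases eq_or_ne n 0 with rfl | hn0
  · simp
  have hn : 0 < ‖n‖ := norm_pos_iff.2 hn0
  set e := ‖n‖⁻¹ • n with he
  have he1 : ‖e‖ = 1 := by rw [he, norm_smul, norm_inv, norm_norm, inv_mul_cancel₀ hn.ne']
  have hne : n = ‖n‖ • e := by rw [he, smul_inv_smul₀ hn.ne']
  have hle : r ≤ ‖r • e - (q - p)‖ := by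
    have : r • e - (q - p) = p + r • e - q := by abel
    rw [this, ← dist_eq_norm]
    exact (hM.le_infDist_normal hc hp (Submodule.smul_mem _ _ hnp) he1 hr).trans
      (Metric.infDist_le_dist_of_mem hq)
  have hsq : r ^ 2 ≤ ‖r • e - (q - p)‖ ^ 2 := by gcongr
  rw [norm_sub_sq_real, norm_smul, he1, real_inner_smul_left, Real.norm_of_nonneg hr₀,
    real_inner_comm] at hsq
  rw [hne, real_inner_smul_right, norm_smul, he1, norm_norm]
  nlinarith

/-! ### Good pairs and the local feature size -/

theorem goodConst_pos {β : ℝ} (hβ₀ : 0 < β) (hβ : β < Real.pi / 2) : 0 < goodConst β :=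
  mul_pos (by norm_num) (Real.tan_pos_of_pos_of_lt_pi_div_two (by linarith) (by linarith))

theorem lineAngle_le_subspaceAngle {U V : Submodule ℝ (Space k)} {u : Space k} (hu : u ∈ U)
    (hu0 : u ≠ 0) : lineAngle V u ≤ subspaceAngle U V := by
  refine le_csSup ⟨Real.pi, ?_⟩ ⟨u, hu, hu0, rfl⟩
  rintro _ ⟨w, -, -, rfl⟩
  exact InnerProductGeometry.angle_le_pi _ _

/-- Project `w` to `U` and the result to `V`; the two angles add up at most. Both being below `π /
2` keeps the projections nonzero. -/
theorem exists_mem_inner_ge_of_lineAngle_le {U V : Submodule ℝ (Space k)} {w : Space k} {a b : ℝ}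
    (ha : a < Real.pi / 2) (hb : b < Real.pi / 2) (hab : a + b ≤ Real.pi)
    (hw : lineAngle U w ≤ a) (hUV : subspaceAngle U V ≤ b) :
    ∃ n ∈ V, n ≠ 0 ∧ Real.cos (a + b) * (‖w‖ * ‖n‖) ≤ inner ℝ w n := by
  set u := U.starProjection w
  have hu0 : u ≠ 0 := fun h => by
    have : lineAngle U w = Real.pi / 2 := by
      rw [lineAngle, show U.starProjection w = 0 from h, InnerProductGeometry.angle_zero_right]
    linarith
  have hu : lineAngle V u ≤ b :=
    (lineAngle_le_subspaceAngle (U.starProjection_apply_mem w) hu0).trans hUV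
  set n := V.starProjection u
  have hn0 : n ≠ 0 := fun h => by
    have : lineAngle V u = Real.pi / 2 := by
      rw [lineAngle, show V.starProjection u = 0 from h, InnerProductGeometry.angle_zero_right]
    linarith
  refine ⟨n, V.starProjection_apply_mem u, hn0, ?_⟩
  have hangle : InnerProductGeometry.angle w n ≤ a + b :=
    (InnerProductGeometry.angle_le_angle_add_angle w u n).trans (add_le_add hw hu)
  rw [← InnerProductGeometry.cos_angle_mul_norm_mul_norm]
  gcongr
  exact Real.cos_le_cos_of_nonneg_of_le_pi (InnerProductGeometry.angle_nonneg _ _) hab hangle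

theorem IsGoodPair.dist_pos {P : Finset (Space k)} {V : Space k → Submodule ℝ (Space k)} {β : ℝ}
    {p q : Space k} (h : IsGoodPair P V β p q) : 0 < dist p q := by
  refine _root_.dist_pos.2 fun hpq => ?_
  subst hpq
  exact h.2.2.2 p h.1 (by simp)

theorem IsGoodPair.lfs_le {s : ℕ} {M : Set (Space k)} (hM : IsSmoothSubmanifold s M)
    (hc : IsCompact M) {P : Finset (Space k)} (hPM : (P : Set (Space k)) ⊆ M)
    {V : Space k → Submodule ℝ (Space k)} {β : ℝ} (hβ₀ : 0 < β) (hβ : β < Real.pi / 2)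
    {p q : Space k} (h : IsGoodPair P V β p q)
    (hV : subspaceAngle (V p) (normalSpace M p) ≤ β / 2) :
    lfs M p ≤ ENNReal.ofReal (dist p q / (2 * Real.sin (β / 2))) := by
  obtain ⟨n, hn, hn0, hin⟩ := exists_mem_inner_ge_of_lineAngle_le
    (a := Real.pi / 2 - β) (b := β / 2) (by linarith) (by linarith)
    (by linarith [Real.pi_pos]) ((le_max_left _ _).trans h.2.2.1) hV
  rw [show Real.pi / 2 - β + β / 2 = Real.pi / 2 - β / 2 by ring, Real.cos_pi_div_two_sub,
    ← dist_eq_norm, dist_comm] at hin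
  have hs : 0 < Real.sin (β / 2) := Real.sin_pos_of_pos_of_lt_pi (by linarith) (by linarith)
  have hD := h.dist_pos
  -- Arguing with every `c < lfs M p` provides a finite radius even if `lfs M p` were infinite.
  refine le_of_forall_lt_imp_le_of_dense fun c hcl => ?_
  obtain ⟨r, hr₀, rfl⟩ : ∃ r : ℝ, 0 ≤ r ∧ c = ENNReal.ofReal r :=
    ⟨_, ENNReal.toReal_nonneg, (ENNReal.ofReal_toReal hcl.ne_top).symm⟩
  have htan := hM.two_mul_inner_normal_le hc (hPM h.1) (hPM h.2.1) hn hr₀ hcl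
  rw [← dist_eq_norm, dist_comm] at htan
  refine ENNReal.ofReal_le_ofReal ?_
  have hn1 : 0 < ‖n‖ := norm_pos_iff.2 hn0
  rw [le_div_iff₀ (by positivity)]
  refine le_of_mul_le_mul_right ?_ (mul_pos hD hn1)
  nlinarith [mul_le_mul_of_nonneg_left hin hr₀]

theorem IsGoodPair.lfs_le_mul_edist {s : ℕ} {M : Set (Space k)} (hM : IsSmoothSubmanifold s M)
    (hc : IsCompact M) {P : Finset (Space k)} (hP : P.Nonempty) {ε : ℝ} (hε₀ : 0 < ε)
    (hdense : IsDenseSample M ε (lfs M) P)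
    {V : Space k → Submodule ℝ (Space k)} {β : ℝ} (hβ₀ : 0 < β) (hβ : β < Real.pi / 2)
    {p q : Space k} (h : IsGoodPair P V β p q)
    (hV : subspaceAngle (V p) (normalSpace M p) ≤ β / 2) {K : ℝ}
    (hK : 1 / (2 * Real.sin (β / 2)) + 1 / 2 ≤ K * goodConst β) (hKε : K * ε ≤ 1 / 2)
    {x : Space k} (hx : x ∈ M) :
    lfs M x ≤ ENNReal.ofReal (2 * (K + 1)) * edist x (midpoint ℝ p q) := by
  have hs : 0 < Real.sin (β / 2) := Real.sin_pos_of_pos_of_lt_pi (by linarith) (by linarith)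
  have hcpos := goodConst_pos hβ₀ hβ
  have hKpos : 0 < K := by
    by_contra! hK0
    have : 0 < 1 / (2 * Real.sin (β / 2)) := by positivity
    nlinarith
  have hD := h.dist_pos
  set m := midpoint ℝ p q with hm
  have hxp : dist x p ≤ dist x m + dist p q / 2 := by
    refine (dist_triangle x m p).trans (add_le_add_right (le_of_eq ?_) _)
    rw [hm, dist_midpoint_left]
    norm_num
    ring
  have hlx : lfs M x ≤ ENNReal.ofReal (dist p q / (2 * Real.sin (β / 2)) + dist x p) := by
    rw [ENNReal.ofReal_add (by positivity) dist_nonneg, ← edist_dist]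
    exact Metric.infEDist_le_infEDist_add_edist.trans
      (add_le_add_left (h.lfs_le hM hc hdense.1 hβ₀ hβ hV) _)
  have hfin : lfs M x ≠ ⊤ := (hlx.trans_lt ENNReal.ofReal_lt_top).ne
  obtain ⟨l, hl₀, hl⟩ : ∃ l : ℝ, 0 ≤ l ∧ lfs M x = ENNReal.ofReal l :=
    ⟨_, ENNReal.toReal_nonneg, (ENNReal.ofReal_toReal hfin).symm⟩
  rw [hl, ENNReal.ofReal_le_ofReal_iff (by positivity)] at hlx
  obtain ⟨y, hyP, hy⟩ := P.finite_toSet.isCompact.exists_infEDist_eq_edist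
    (Finset.coe_nonempty.2 hP) x
  have hxy := hdense.2 x hx
  rw [hy, hl, ← ENNReal.ofReal_mul hε₀.le, edist_dist,
    ENNReal.ofReal_le_ofReal_iff (by positivity)] at hxy
  -- The sample point `y` nearest to `x` lies outside the empty ball about `m`.
  have hempty : goodConst β * dist p q < dist x m + ε * l := by
    have h1 := h.2.2.2 y hyP
    rw [Metric.mem_closedBall, not_le] at h1
    have h2 := dist_triangle y x m
    rw [dist_comm y x] at h2
    linarith
  rw [hl, edist_dist, ← ENNReal.ofReal_mul (by positivity)]
  refine ENNReal.ofReal_le_ofReal ?_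
  have h1 : dist p q / (2 * Real.sin (β / 2)) + dist p q / 2 ≤ K * (dist x m + ε * l) := by
    calc dist p q / (2 * Real.sin (β / 2)) + dist p q / 2
        = (1 / (2 * Real.sin (β / 2)) + 1 / 2) * dist p q := by ring
      _ ≤ K * goodConst β * dist p q := by gcongr
      _ = K * (goodConst β * dist p q) := by ring
      _ ≤ K * (dist x m + ε * l) := by gcongr
  -- The estimates give `l ≤ (K + 1) * dist x m + K * ε * l`, and the last term is at most `l / 2`.
  nlinarith [mul_le_mul_of_nonneg_right hKε hl₀]

theorem lfs_le_mul_lnfs {s : ℕ} {M : Set (Space k)} (hM : IsSmoothSubmanifold s M)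
    (hc : IsCompact M) {P : Finset (Space k)} (hP : P.Nonempty) {ε : ℝ} (hε₀ : 0 < ε)
    (hdense : IsDenseSample M ε (lfs M) P)
    {V : Space k → Submodule ℝ (Space k)} {β : ℝ} (hβ₀ : 0 < β) (hβ : β < Real.pi / 2)
    (hV : ∀ p ∈ P, subspaceAngle (V p) (normalSpace M p) ≤ β / 2) {K : ℝ} (hK₀ : 0 < K)
    (hK : 1 / (2 * Real.sin (β / 2)) + 1 / 2 ≤ K * goodConst β) (hKε : K * ε ≤ 1 / 2)
    {x : Space k} (hx : x ∈ M) :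
    lfs M x ≤ ENNReal.ofReal (2 * (K + 1)) * lnfs P V β x := by
  have hC : ENNReal.ofReal (2 * (K + 1)) ≠ 0 := by
    rw [Ne, ENNReal.ofReal_eq_zero, not_le]
    positivity
  rw [← ENNReal.div_le_iff' hC ENNReal.ofReal_ne_top]
  refine Metric.le_infEDist.2 ?_
  rintro _ ⟨p, q, h, rfl⟩
  rw [ENNReal.div_le_iff' hC ENNReal.ofReal_ne_top]
  exact h.lfs_le_mul_edist hM hc hP hε₀ hdense hβ₀ hβ (hV p h.1) hK hKε hx

/-! ### The decimation -/

theorem Decimate.subset {ρ : ℝ} {φ : Space k → ℝ≥0∞} {S Q : Finset (Space k)}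
    (h : Decimate ρ φ S Q) : Q ⊆ S := by
  induction h with
  | done => exact Finset.Subset.refl _
  | step S Q q hq hmax hrun ih =>
    exact Finset.insert_subset hq
      (ih.trans ((Finset.filter_subset _ _).trans (Finset.erase_subset _ _)))

theorem Decimate.exists_edist_le {ρ : ℝ} {φ : Space k → ℝ≥0∞} {S Q : Finset (Space k)}
    (h : Decimate ρ φ S Q) : ∀ p ∈ S, ∃ q ∈ Q, edist p q ≤ ENNReal.ofReal ρ * φ q := by
  induction h with
  | done => simp
  | step S Q q hq hmax hrun ih =>
    intro p hp
    by_cases hpq : edist q p ≤ ENNReal.ofReal ρ * φ q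
    · exact ⟨q, Finset.mem_insert_self _ _, edist_comm p q ▸ hpq⟩
    · have hne : p ≠ q := by
        rintro rfl
        simp at hpq
      obtain ⟨r, hr, hle⟩ := ih p (by simp [hne, hp, not_le.1 hpq])
      exact ⟨r, Finset.mem_insert_of_mem hr, hle⟩

/-- A point extracted later has survived the deletion around each earlier `q`, and the extraction
order makes `φ q` the larger of the two values. -/
theorem Decimate.isSparseSample {ρ : ℝ} {φ : Space k → ℝ≥0∞} {S Q : Finset (Space k)}
    (h : Decimate ρ φ S Q) : IsSparseSample ρ φ Q := by
  induction h with
  | done => simp [IsSparseSample]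
  | step S Q q hq hmax hrun ih =>
    have hfar : ∀ p ∈ Q, ENNReal.ofReal ρ * φ q ≤ edist q p ∧ φ p ≤ φ q := fun p hp => by
      have hpS := hrun.subset hp
      rw [Finset.mem_filter, not_le] at hpS
      exact ⟨hpS.2.le, hmax p (Finset.mem_of_mem_erase hpS.1)⟩
    intro a ha b hb hab
    rcases Finset.mem_insert.1 ha with rfl | haQ <;> rcases Finset.mem_insert.1 hb with rfl | hbQ
    · exact absurd rfl hab
    · exact (hfar b hbQ).1
    · rw [edist_comm]
      exact (mul_le_mul_right (hfar a haQ).2 _).trans (hfar a haQ).1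
    · exact ih a haQ b hbQ hab

/-! ### Uniformity of the output -/

/-- The decimation of a sample that is `η`-dense with respect to the distance to `L`. -/
theorem Decimate.exists_mem_edist_le {M L : Set (Space k)} {ρ η : ℝ} (hρ₀ : 0 < ρ)
    (hρ : ρ ≤ 1 / 12) (hη₀ : 0 ≤ η) (hη : η ≤ ρ / 12) {P Q : Finset (Space k)}
    (hP : P.Nonempty) (hdense : IsDenseSample M η (fun x => Metric.infEDist x L) P)
    (h : Decimate ρ (fun x => Metric.infEDist x L) P Q) {x : Space k} (hx : x ∈ M) :
    ∃ q ∈ Q, edist x q ≤ ENNReal.ofReal (4 / 3 * ρ) * Metric.infEDist x L ∧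
      edist x q ≤ ENNReal.ofReal (6 * ρ / 5) * Metric.infEDist q L := by
  obtain ⟨p, hpP, hp⟩ := P.finite_toSet.isCompact.exists_infEDist_eq_edist
    (Finset.coe_nonempty.2 hP) x
  have hxp := hdense.2 x hx
  rw [hp] at hxp
  obtain ⟨q, hqQ, hpq⟩ := h.exists_edist_le p hpP
  refine ⟨q, hqQ, ?_⟩
  rcases L.eq_empty_or_nonempty with rfl | hL
  -- With `L` empty both right-hand sides are infinite.
  · have h1 : ENNReal.ofReal (4 / 3 * ρ) ≠ 0 := by
      rw [Ne, ENNReal.ofReal_eq_zero, not_le]; positivity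
    have h2 : ENNReal.ofReal (6 * ρ / 5) ≠ 0 := by
      rw [Ne, ENNReal.ofReal_eq_zero, not_le]; positivity
    simp [ENNReal.mul_top h1, ENNReal.mul_top h2]
  · have hreal : ∀ z, Metric.infEDist z L = ENNReal.ofReal (Metric.infDist z L) := fun z =>
      (ENNReal.ofReal_toReal (Metric.infEDist_ne_top hL)).symm
    have hnn : ∀ z, 0 ≤ Metric.infDist z L := fun z => Metric.infDist_nonneg
    have hX := hnn x
    have hY := hnn q
    simp only [hreal, edist_dist] at hxp hpq ⊢
    rw [← ENNReal.ofReal_mul hη₀, ENNReal.ofReal_le_ofReal_iff (by positivity)] at hxp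
    rw [← ENNReal.ofReal_mul hρ₀.le, ENNReal.ofReal_le_ofReal_iff (by positivity)] at hpq
    rw [← ENNReal.ofReal_mul (by positivity), ← ENNReal.ofReal_mul (by positivity),
      ENNReal.ofReal_le_ofReal_iff (by positivity), ENNReal.ofReal_le_ofReal_iff (by positivity)]
    have hd := dist_triangle x p q
    have hYX := Metric.infDist_le_infDist_add_dist (s := L) (x := q) (y := x)
    have hXY := Metric.infDist_le_infDist_add_dist (s := L) (x := x) (y := q)
    rw [dist_comm] at hYX
    have hd₀ : 0 ≤ dist x q := dist_nonneg
    have e1 := mul_le_mul_of_nonneg_left hYX hρ₀.le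
    have e2 := mul_le_mul_of_nonneg_right hη hX
    have e3 := mul_le_mul_of_nonneg_right hρ hd₀
    have e4 := mul_le_mul_of_nonneg_left hXY hρ₀.le
    have e5 := mul_nonneg hρ₀.le hX
    have e6 := mul_nonneg hρ₀.le hY
    -- With `X`, `Y` the distances of `x`, `q` to `L` and `d = dist x q`, one has `d ≤ (ρ / 12) * X
    -- + ρ * Y`. Substituting `Y ≤ X + d` gives `d ≤ (13 / 11) * ρ * X`; substituting `X ≤ Y + d`
    -- gives `d ≤ (12 / 11) * ρ * Y`.
    constructor <;> linarith

end Sparsification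

theorem theorem2 (β : ℝ) (hβ₀ : 0 < β) (hβ : β < Real.pi / 2)
    (ρ : ℝ) (hρ₀ : 0 < ρ) (hρ : ρ ≤ 1 / 12)
    (ν : ℝ → ℝ) (hν : ν =O[𝓝[>] 0] fun ε : ℝ => ε) :
    ∃ ε₀ : ℝ, 0 < ε₀ ∧ ∀ ε : ℝ, 0 < ε → ε ≤ ε₀ →
      ∀ (k s : ℕ) (M : Set (Space k)), IsCompact M → IsSmoothSubmanifold s M →
      ∀ P : Finset (Space k), P.Nonempty → IsDenseSample M ε (lfs M) P →
      ∀ V : Space k → Submodule ℝ (Space k),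
        (∀ p ∈ P, Module.finrank ℝ (V p) = Module.finrank ℝ (normalSpace M p) ∧
          subspaceAngle (V p) (normalSpace M p) ≤ ν ε) →
      ∀ Q : Finset (Space k), IsDecimationOutput P V β ρ Q →
        IsUniformSample M (4 / 3 * ρ) ρ (lnfs P V β) Q ∧
        IsLSample M (6 * ρ / 5) (leanSet P V β) Q := by
  have hs : 0 < Real.sin (β / 2) := Real.sin_pos_of_pos_of_lt_pi (by linarith) (by linarith)
  have hc := goodConst_pos hβ₀ hβ
  set K : ℝ := (1 / (2 * Real.sin (β / 2)) + 1 / 2) / goodConst β with hKdef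
  have hK₀ : 0 < K := by positivity
  have hK : 1 / (2 * Real.sin (β / 2)) + 1 / 2 ≤ K * goodConst β := by
    rw [hKdef, div_mul_cancel₀ _ hc.ne']
  have hlim : Tendsto ν (𝓝[>] 0) (𝓝 0) := hν.trans_tendsto (tendsto_id.mono_left nhdsWithin_le_nhds)
  obtain ⟨δ, hδ, hδν⟩ := mem_nhdsGT_iff_exists_Ioc_subset.1
    (hlim.eventually (gt_mem_nhds (show (0 : ℝ) < β / 2 by linarith)))
  have hδ : 0 < δ := hδ
  -- The three bounds ensure in turn `ν ε < β / 2`, the absorption condition `K * ε ≤ 1 / 2`, and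
  -- density `ε * (2 * (K + 1)) ≤ ρ / 12` with respect to `lnfs`.
  refine ⟨min δ (min (1 / (2 * K)) (ρ / (24 * (K + 1)))), by positivity, ?_⟩
  intro ε hε₀ hε k s M hMc hM P hP hdense V hV Q hQ
  have hKε : K * ε ≤ 1 / 2 := by
    have : ε ≤ 1 / (2 * K) := hε.trans ((min_le_right _ _).trans (min_le_left _ _))
    rw [le_div_iff₀ (by positivity)] at this
    linarith
  have hη : ε * (2 * (K + 1)) ≤ ρ / 12 := by
    have : ε ≤ ρ / (24 * (K + 1)) := hε.trans ((min_le_right _ _).trans (min_le_right _ _))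
    rw [le_div_iff₀ (by positivity)] at this
    linarith
  have hνε : ν ε ≤ β / 2 := (hδν ⟨hε₀, hε.trans (min_le_left _ _)⟩ : ν ε < β / 2).le
  have hdense' : IsDenseSample M (ε * (2 * (K + 1))) (lnfs P V β) P := by
    refine ⟨hdense.1, fun x hx => (hdense.2 x hx).trans ?_⟩
    rw [ENNReal.ofReal_mul hε₀.le, mul_assoc]
    gcongr
    exact lfs_le_mul_lnfs hM hMc hP hε₀ hdense hβ₀ hβ (fun p hp => (hV p hp).2.trans hνε) hK₀ hK
      hKε hx
  have hcover := fun x hx =>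
    Decimate.exists_mem_edist_le (x := x) hρ₀ hρ (by positivity) hη hP hdense' hQ hx
  have hQM : (Q : Set (Space k)) ⊆ M :=
    (Finset.coe_subset.2 (Decimate.subset hQ)).trans hdense.1
  refine ⟨⟨⟨hQM, fun x hx => ?_⟩, Decimate.isSparseSample hQ⟩, hQM, fun x hx => ?_⟩
  · obtain ⟨q, hq, hle, -⟩ := hcover x hx
    exact (Metric.infEDist_le_edist_of_mem hq).trans hle
  · obtain ⟨q, hq, -, hle⟩ := hcover x hx
    exact ⟨q, hq, hle⟩
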